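/- For every $d\in\mathbb N$ let $\phi=\phi_d$ be a probability measure on $\mathbb R^d$ that is even (invariant under $x\mapsto -x$) and assigns measure zero to every hyperplane through the origin. Let $k=k(d)$ and $N=N(d)$ be nonnegative integers with $k<d<N$ for all sufficiently large $d$, and let $X_1,\dots,X_N$ be independent random vectors in $\mathbb R^d$ with distribution $\phi$. The Cover–Efron cone $C_N$ is the random cone $\mathrm{pos}\{X_1,\dots,X_N\}$ (the set of all nonnegative linear combinations of $X_1,\dots,X_N$) under the condition that this positive hull is different from $\mathbb R^d$. For a polyhedral convex cone $C\subset\mathbb R^d$ let $f_k(C)$ be the number of its $k$-dimensional faces, so that $$\mathbb E f_k(C_N)=\mathbb E\bigl[f_k(\mathrm{pos}\{X_1,\dots,X_N\})\,\big|\,\mathrm{pos}\{X_1,\dots,X_N\}\ne\mathbb R^d\bigr].$$ Let $\Phi$ be the distribution function of the standard normal distribution. Suppose that $$\frac dN\to\delta,\qquad \frac kd\to\rho\qquad (d\to\infty),\qquad \tfrac12<\delta<1,\qquad \rho=\rho_W(\delta):=\max\{0,2-1/\delta\}=2-1/\delta .$$ Then, for all sufficiently large $d$, the conditioning event has positive probability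 and the conditional expectation $\mathbb E f_k(C_N)$ exists and is finite, and the following hold. (a) If $(N-2d+k)/\sqrt d\to c$ as $d\to\infty$, with $c\in\mathbb R$ (possibly $c=0$), then $$\lim_{d\to\infty}\frac{\mathbb E f_k(C_N)}{\binom Nk}=\Phi\left(-\frac{c}{\sqrt{2(1-\rho)}}\right)\in(0,1).$$ (b) If $N-2d+k\ge c\,d^{\alpha}$ for all sufficiently large $d$, with constants $\frac12<\alpha<1$ and $c>0$, then $\displaystyle\lim_{d\to\infty}\frac{\mathbb E f_k(C_N)}{\binom Nk}=0$. (c) If $-c\,d^{\alpha}\le N-2d+k\le c\,d^{\alpha}$ for all sufficiently large $d$, with constants $0<\alpha<\frac12$ and $c\ge0$, then $\displaystyle\lim_{d\to\infty}\frac{\mathbb E f_k(C_N)}{\binom Nk}=\frac12$. (d) If $N-2d+k\le c\,d^{\alpha}$ for all sufficiently large $d$, with constants $\frac12<\alpha<1$ and $c<0$, then $\displaystyle\lim_{d\to\infty}\frac{\mathbb E f_k(C_N)}{\binom Nk}=1$. -/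

import Mathlib

open Filter Topology MeasureTheory ProbabilityTheory

/-- A directional law on `ℝ^d`: a probability measure that is even and that gives measure zero to
every hyperplane through the origin. -/
structure IsEvenGeneric {d : ℕ} (φ : Measure (EuclideanSpace ℝ (Fin d))) : Prop where
  isProbabilityMeasure : IsProbabilityMeasure φ
  even : φ.map (fun x => -x) = φ
  hyperplane : ∀ u : EuclideanSpace ℝ (Fin d), u ≠ 0 → φ {x | inner ℝ u x = 0} = 0

/-- The positive hull `pos {x_1, …, x_N}`: all nonnegative linear combinations of the `x_i`. -/
noncomputable def posHull {d N : ℕ} (x : Fin N → EuclideanSpace ℝ (Fin d)) :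
    PointedCone ℝ (EuclideanSpace ℝ (Fin d)) :=
  PointedCone.hull ℝ (Set.range x)

/-- The number `f_k(C)` of `k`-dimensional faces of a convex cone `C` in `ℝ^d`; the dimension of a
face is the dimension of its linear span. (A polyhedral cone has only finitely many faces.) -/
noncomputable def faceNumber {d : ℕ} (k : ℕ) (C : PointedCone ℝ (EuclideanSpace ℝ (Fin d))) : ℕ :=
  {F : PointedCone ℝ (EuclideanSpace ℝ (Fin d)) |
    F.IsFaceOf C ∧
      Module.finrank ℝ (Submodule.span ℝ (F : Set (EuclideanSpace ℝ (Fin d)))) = k}.ncard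

/-- The event that the positive hull of the random vectors `X_1, …, X_N` is not all of `ℝ^d`. -/
def posHullProper {Ω : Type*} {d N : ℕ} (X : Fin N → Ω → EuclideanSpace ℝ (Fin d)) : Set Ω :=
  {ω | posHull (fun i => X i ω) ≠ ⊤}

/-- The probability measure of the Cover–Efron model: the original probability, conditioned on the
event that the positive hull of `X_1, …, X_N` is not all of `ℝ^d`. Under this measure the random
cone `pos {X_1, …, X_N}` is the Cover–Efron cone `C_N`. -/
noncomputable def coverEfronMeasure {Ω : Type*} [MeasurableSpace Ω] (P : Measure Ω) {d N : ℕ}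
    (X : Fin N → Ω → EuclideanSpace ℝ (Fin d)) : Measure Ω :=
  ProbabilityTheory.cond P (posHullProper X)

/-- The expected number `𝔼 f_k(C_N)` of `k`-faces of the Cover–Efron cone `C_N` generated by
`X_1, …, X_N`. -/
noncomputable def expectedFaceNumber {Ω : Type*} [MeasurableSpace Ω] (P : Measure Ω) {d N : ℕ}
    (X : Fin N → Ω → EuclideanSpace ℝ (Fin d)) (k : ℕ) : ℝ :=
  ∫ ω, (faceNumber k (posHull (fun i => X i ω)) : ℝ) ∂(coverEfronMeasure P X)

/-- The threshold `ρ_W(δ) = max {0, 2 - 1/δ}`. -/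
noncomputable def rhoW (δ : ℝ) : ℝ := max 0 (2 - δ⁻¹)

/-- The distribution function `Φ` of the standard normal distribution. -/
noncomputable def stdNormalCDF (x : ℝ) : ℝ := cdf (gaussianReal 0 1) x

/-! Write p(n, m) for `cellProb n m`, the fraction of the 2^n sign patterns realized by linear
functionals on n vectors in general position in ℝ^m. The proof reduces the face ratio to a quotient
of two such fractions and applies the central limit theorem to each.

Geometry: almost surely the X_i are in general position. For k < d, the k-faces of the positive hull
then correspond exactly to the k-element index sets I for which some functional vanishes on I and is
positive elsewhere (`InGeneralPosition.faceNumber_posHull`). Evenness makes all sign flips of the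
vectors equally likely, so averaging over the flips outside I turns the probability of this event
into p(N - k, d - k), by Schläfli's count `card_realizesSigns`. For I = ∅ it is p(N, d), the
probability of a proper hull. A non-proper hull has no k-faces, so conditioning merely divides, and
the ratio is p(N - k, d - k) / p(N, d) (`expectedFaceNumber_eq`).

Asymptotics: Schläfli's recursion is that of a simple random walk: p(n + 1, m) = P(S_n < 2m - n),
with S_n a sum of n fair signs (`cellProb_eq_measureReal_walk`). In the denominator the threshold is
of order (2 - 1/δ)d, far beyond √d, so the limit is 1. In the numerator n = N - k - 1 and m = d - k,
so the threshold is -(N - 2d + k) + 1, while n/d → 1/δ - ρ = 2(1 - ρ). Hence (N - 2d + k)/√d decides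
the limit, and its four regimes give (a)–(d). -/

/-- The number of cells into which `n` hyperplanes in general position through the origin divide
an `m`-dimensional space, given by Schläfli's recursion. -/
def cellCount : ℕ → ℕ → ℕ
  | 0, _ => 1
  | _ + 1, 0 => 0
  | n + 1, m + 1 => cellCount n (m + 1) + cellCount n m

/-- Any at most `d` of the vectors in `ℝ^d` are linearly independent. -/
def InGeneralPosition {d N : ℕ} (x : Fin N → EuclideanSpace ℝ (Fin d)) : Prop :=
  ∀ J : Finset (Fin N), J.card ≤ d → LinearIndepOn ℝ x (J : Set (Fin N))

/-- Some linear functional vanishes on the vectors with index in `J`, is positive on those with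
index in `S ∩ T` and negative on those with index in `S \ T`. -/
def RealizesSigns {d N : ℕ} (x : Fin N → EuclideanSpace ℝ (Fin d)) (J S T : Finset (Fin N)) :
    Prop :=
  ∃ u : EuclideanSpace ℝ (Fin d), (∀ j ∈ J, inner ℝ u (x j) = 0) ∧
    ∀ i ∈ S, (i ∈ T → 0 < inner ℝ u (x i)) ∧ (i ∉ T → inner ℝ u (x i) < 0)

/-- Some linear functional vanishes exactly on the vectors with index in `I` and is positive on
the others. -/
def Supports {d N : ℕ} (x : Fin N → EuclideanSpace ℝ (Fin d)) (I : Finset (Fin N)) : Prop :=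
  ∃ u : EuclideanSpace ℝ (Fin d), (∀ i ∈ I, inner ℝ u (x i) = 0) ∧ ∀ i ∉ I, 0 < inner ℝ u (x i)

/-- Reverse the vectors with index outside `T`. -/
def flipSigns {d N : ℕ} (T : Finset (Fin N)) (x : Fin N → EuclideanSpace ℝ (Fin d)) :
    Fin N → EuclideanSpace ℝ (Fin d) :=
  fun i => if i ∈ T then x i else -x i

/-! ### Schläfli's count of sign patterns -/

section

variable {d N : ℕ} {x : Fin N → EuclideanSpace ℝ (Fin d)}

noncomputable instance (J S : Finset (Fin N)) : DecidablePred (RealizesSigns x J S) :=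
  Classical.decPred _

noncomputable instance : DecidablePred (Supports x) := Classical.decPred _

/-- Values prescribed on independent vectors extend to a linear functional, which the inner product
represents. This supplies the directions for all later perturbations. -/
theorem exists_inner_eq_of_linearIndepOn {J : Finset (Fin N)}
    (h : LinearIndepOn ℝ x (J : Set (Fin N))) (c : Fin N → ℝ) :
    ∃ v : EuclideanSpace ℝ (Fin d), ∀ j ∈ J, inner ℝ v (x j) = c j := by
  obtain ⟨g, hg⟩ := LinearMap.exists_extend
    ((Module.Basis.span h).constr ℝ (fun j : (J : Set (Fin N)) => c j))
  refine ⟨(InnerProductSpace.toDual ℝ _).symm (LinearMap.toContinuousLinearMap g), fun j hj => ?_⟩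
  rw [InnerProductSpace.toDual_symm_apply]
  have := LinearMap.congr_fun hg (Module.Basis.span h ⟨j, hj⟩)
  rw [Module.Basis.constr_basis] at this
  have hb : ((Module.Basis.span h ⟨j, hj⟩ : Submodule.span ℝ _) : EuclideanSpace ℝ (Fin d)) = x j :=
    congrArg Subtype.val (Module.Basis.span_apply h _)
  simpa [hb] using this

theorem eq_zero_of_inner_eq_zero {J : Finset (Fin N)}
    (h : LinearIndepOn ℝ x (J : Set (Fin N))) (hJ : J.card = d) {u : EuclideanSpace ℝ (Fin d)}
    (hu : ∀ j ∈ J, inner ℝ u (x j) = 0) : u = 0 := by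
  have hs : Submodule.span ℝ (Set.range fun j : (J : Set (Fin N)) => x j) = ⊤ :=
    LinearIndependent.span_eq_top_of_card_eq_finrank' h (by simp [hJ])
  have hle : Submodule.span ℝ (Set.range fun j : (J : Set (Fin N)) => x j) ≤
      LinearMap.ker (innerₛₗ ℝ u) := by
    rw [Submodule.span_le]
    rintro _ ⟨j, rfl⟩
    exact hu j j.2
  have : u ∈ LinearMap.ker (innerₛₗ ℝ u) := hle (hs ▸ Submodule.mem_top)
  simpa using this

/-- A small perturbation does not change the signs of nonzero inner products. -/
theorem exists_perturbation (x : Fin N → EuclideanSpace ℝ (Fin d))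
    (u v : EuclideanSpace ℝ (Fin d)) :
    ∃ t : ℝ, 0 < t ∧ ∀ i, (0 < inner ℝ u (x i) → 0 < inner ℝ (u + t • v) (x i)) ∧
      (inner ℝ u (x i) < 0 → inner ℝ (u + t • v) (x i) < 0) := by
  have h : ∀ i, ∀ᶠ t in 𝓝[>] (0 : ℝ), (0 < inner ℝ u (x i) → 0 < inner ℝ (u + t • v) (x i)) ∧
      (inner ℝ u (x i) < 0 → inner ℝ (u + t • v) (x i) < 0) := by
    intro i
    have hc : Tendsto (fun t : ℝ => (inner ℝ (u + t • v) (x i) : ℝ)) (𝓝[>] 0)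
        (𝓝 (inner ℝ u (x i))) := by
      have : Continuous (fun t : ℝ => (inner ℝ (u + t • v) (x i) : ℝ)) := by fun_prop
      simpa using (this.tendsto 0).mono_left nhdsWithin_le_nhds
    rw [eventually_and]
    constructor
    · by_cases h0 : 0 < inner ℝ u (x i)
      · filter_upwards [hc.eventually_const_lt h0] with t ht _ using ht
      · exact Eventually.of_forall fun t h => absurd h h0
    · by_cases h0 : inner ℝ u (x i) < 0
      · filter_upwards [hc.eventually_lt_const h0] with t ht _ using ht
      · exact Eventually.of_forall fun t h => absurd h h0
  obtain ⟨t, ht, h0⟩ := ((eventually_all.2 h).and self_mem_nhdsWithin).exists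
  exact ⟨t, h0, ht⟩

theorem RealizesSigns.mono {J S S' T T' : Finset (Fin N)} (h : RealizesSigns x J S T)
    (hS : S' ⊆ S) (hT : ∀ i ∈ S', i ∈ T' ↔ i ∈ T) : RealizesSigns x J S' T' := by
  obtain ⟨u, hu, hs⟩ := h
  refine ⟨u, hu, fun i hi => ?_⟩
  rw [hT i hi]
  exact hs i (hS hi)

/-- A realizing functional either already has a sign at `x a`, or can be tilted slightly to acquire
one. -/
theorem realizesSigns_insert_or {J S T : Finset (Fin N)} {a : Fin N} (haS : a ∉ S) (haJ : a ∉ J)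
    (haT : a ∉ T) (hli : LinearIndepOn ℝ x ((insert a J : Finset (Fin N)) : Set (Fin N))) :
    RealizesSigns x J (insert a S) T ∨ RealizesSigns x J (insert a S) (insert a T) ↔
      RealizesSigns x J S T := by
  constructor
  · rintro (h | h)
    · exact h.mono (Finset.subset_insert _ _) fun i _ => Iff.rfl
    · refine h.mono (Finset.subset_insert _ _) fun i hi => ?_
      have : i ≠ a := fun h => haS (h ▸ hi)
      simp [this]
  · rintro ⟨u, hu, hs⟩
    have key : ∀ w : EuclideanSpace ℝ (Fin d), (∀ j ∈ J, inner ℝ w (x j) = 0) →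
        (∀ i ∈ S, (i ∈ T → 0 < inner ℝ w (x i)) ∧ (i ∉ T → inner ℝ w (x i) < 0)) →
        inner ℝ w (x a) ≠ 0 →
        RealizesSigns x J (insert a S) T ∨ RealizesSigns x J (insert a S) (insert a T) := by
      intro w hw hws ha
      rcases ha.lt_or_gt with ha | ha
      · refine .inl ⟨w, hw, fun i hi => ?_⟩
        rcases Finset.mem_insert.1 hi with rfl | hi
        · exact ⟨fun h => absurd h haT, fun _ => ha⟩
        · exact hws i hi
      · refine .inr ⟨w, hw, fun i hi => ?_⟩
        rcases Finset.mem_insert.1 hi with rfl | hi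
        · exact ⟨fun _ => ha, fun h => absurd (Finset.mem_insert_self _ _) h⟩
        · have : i ≠ a := fun h => haS (h ▸ hi)
          simpa [this] using hws i hi
    -- On the hyperplane of `x a`, move along a `v` that is orthogonal to `J` and has inner product
    -- 1 with `x a`.
    by_cases ha : inner ℝ u (x a) = 0
    · obtain ⟨v, hv⟩ := exists_inner_eq_of_linearIndepOn hli (fun i => if i = a then 1 else 0)
      obtain ⟨t, ht, hts⟩ := exists_perturbation x u v
      have hva : inner ℝ v (x a) = 1 := by simpa using hv a (Finset.mem_insert_self _ _)
      refine key (u + t • v) (fun j hj => ?_)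
        (fun i hi => ⟨fun h => (hts i).1 ((hs i hi).1 h), fun h => (hts i).2 ((hs i hi).2 h)⟩) ?_
      · have : j ≠ a := fun h => haJ (h ▸ hj)
        have h0 : inner ℝ v (x j) = 0 := by
          simpa [this] using hv j (Finset.mem_insert_of_mem hj)
        simp [inner_add_left, inner_smul_left, hu j hj, h0]
      · simp [inner_add_left, inner_smul_left, ha, hva, ht.ne']
    · exact key u hu hs ha

/-- A cell is cut by the hyperplane of `x a` exactly when it has points on both sides: a segment
joining the two sides crosses it, and a crossing point can be pushed either way. -/
theorem realizesSigns_insert_and {J S T : Finset (Fin N)} {a : Fin N} (haS : a ∉ S) (haJ : a ∉ J)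
    (haT : a ∉ T) (hli : LinearIndepOn ℝ x ((insert a J : Finset (Fin N)) : Set (Fin N))) :
    RealizesSigns x J (insert a S) T ∧ RealizesSigns x J (insert a S) (insert a T) ↔
      RealizesSigns x (insert a J) S T := by
  have hne : ∀ i ∈ S, i ≠ a := fun i hi h => haS (h ▸ hi)
  constructor
  · rintro ⟨⟨u, hu, hus⟩, ⟨v, hv, hvs⟩⟩
    have hua := (hus a (Finset.mem_insert_self _ _)).2 haT
    have hva := (hvs a (Finset.mem_insert_self _ _)).1 (Finset.mem_insert_self _ _)
    -- Both coefficients are positive, so common signs survive, and they are chosen to cancel the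
    -- inner product with `x a`.
    refine ⟨inner ℝ v (x a) • u + (-inner ℝ u (x a)) • v, fun j hj => ?_, fun i hi => ?_⟩
    · rcases Finset.mem_insert.1 hj with rfl | hj
      · simp only [inner_add_left, inner_smul_left, conj_trivial]
        ring
      · simp [inner_add_left, inner_smul_left, hu j hj, hv j hj]
    · have h1 := hus i (Finset.mem_insert_of_mem hi)
      have h2 := hvs i (Finset.mem_insert_of_mem hi)
      simp only [Finset.mem_insert, hne i hi, false_or] at h2
      simp only [inner_add_left, inner_smul_left, conj_trivial]
      refine ⟨fun h => ?_, fun h => ?_⟩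
      · exact add_pos (mul_pos hva (h1.1 h)) (mul_pos (neg_pos.2 hua) (h2.1 h))
      · exact add_neg (mul_neg_of_pos_of_neg hva (h1.2 h))
          (mul_neg_of_pos_of_neg (neg_pos.2 hua) (h2.2 h))
  · rintro ⟨u, hu, hus⟩
    have hua := hu a (Finset.mem_insert_self _ _)
    have key : ∀ c : ℝ, ∃ w : EuclideanSpace ℝ (Fin d), (∀ j ∈ J, inner ℝ w (x j) = 0) ∧
        (∀ i ∈ S, (i ∈ T → 0 < inner ℝ w (x i)) ∧ (i ∉ T → inner ℝ w (x i) < 0)) ∧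
        ∃ t : ℝ, 0 < t ∧ inner ℝ w (x a) = t * c := by
      intro c
      obtain ⟨v, hv⟩ := exists_inner_eq_of_linearIndepOn hli (fun i => if i = a then c else 0)
      obtain ⟨t, ht, hts⟩ := exists_perturbation x u v
      have hva : inner ℝ v (x a) = c := by simpa using hv a (Finset.mem_insert_self _ _)
      refine ⟨u + t • v, fun j hj => ?_, fun i hi =>
        ⟨fun h => (hts i).1 ((hus i hi).1 h), fun h => (hts i).2 ((hus i hi).2 h)⟩, t, ht, ?_⟩
      · have : j ≠ a := fun h => haJ (h ▸ hj)
        have h0 : inner ℝ v (x j) = 0 := by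
          simpa [this] using hv j (Finset.mem_insert_of_mem hj)
        simp [inner_add_left, inner_smul_left, hu j (Finset.mem_insert_of_mem hj), h0]
      · simp [inner_add_left, inner_smul_left, hua, hva]
    constructor
    · obtain ⟨w, hw, hws, t, ht, hwa⟩ := key (-1)
      refine ⟨w, hw, fun i hi => ?_⟩
      rcases Finset.mem_insert.1 hi with rfl | hi
      · exact ⟨fun h => absurd h haT, fun _ => by rw [hwa]; linarith⟩
      · exact hws i hi
    · obtain ⟨w, hw, hws, t, ht, hwa⟩ := key 1
      refine ⟨w, hw, fun i hi => ?_⟩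
      rcases Finset.mem_insert.1 hi with rfl | hi
      · exact ⟨fun _ => by rw [hwa]; linarith, fun h => absurd (Finset.mem_insert_self _ _) h⟩
      · simpa [hne i hi] using hws i hi

/-- **Schläfli's theorem**: the number of sign patterns realized by vectors in general position. -/
theorem card_realizesSigns (hx : InGeneralPosition x) (S : Finset (Fin N)) :
    ∀ J : Finset (Fin N), Disjoint J S → J.card ≤ d →
      (S.powerset.filter (RealizesSigns x J S)).card = cellCount S.card (d - J.card) := by
  induction S using Finset.induction_on with
  | empty =>
    intro J _ _
    have : RealizesSigns x J ∅ ∅ := ⟨0, by simp, by simp⟩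
    simp [Finset.filter_singleton, this, cellCount]
  | insert a S haS ih =>
    intro J hJS hJ
    rw [Finset.disjoint_insert_right] at hJS
    rw [Finset.card_insert_of_notMem haS]
    rcases hJ.eq_or_lt with hJd | hJd
    -- Orthogonality to `d` independent vectors forces `u = 0`, which has no strict signs; this is
    -- the boundary value 0 of `cellCount`.
    · rw [hJd, Nat.sub_self, cellCount, Finset.card_eq_zero, Finset.filter_eq_empty_iff]
      rintro T _ ⟨u, hu, hs⟩
      have h0 := eq_zero_of_inner_eq_zero (hx J hJ) hJd hu
      have := hs a (Finset.mem_insert_self _ _)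
      by_cases haT : a ∈ T <;> simp [h0, haT] at this
    · have hcard : (insert a J).card = J.card + 1 := Finset.card_insert_of_notMem hJS.1
      obtain ⟨m, hm⟩ : ∃ m, d - J.card = m + 1 := ⟨d - J.card - 1, by omega⟩
      have hm' : d - (insert a J).card = m := by omega
      have h1 := ih J hJS.2 hJ
      have h2 := ih (insert a J) (by rw [Finset.disjoint_insert_left]; exact ⟨haS, hJS.2⟩)
        (by omega)
      rw [hm] at h1
      rw [hm'] at h2
      rw [hm, cellCount, ← h1, ← h2, Finset.card_filter, Finset.sum_powerset_insert haS,
        Finset.card_filter, Finset.card_filter, ← Finset.sum_add_distrib, ← Finset.sum_add_distrib]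
      refine Finset.sum_congr rfl fun T hT => ?_
      have haT : a ∉ T := fun h => haS (Finset.mem_powerset.1 hT h)
      have hli := hx (insert a J) (by omega)
      have hor := realizesSigns_insert_or haS hJS.1 haT hli
      have hand := realizesSigns_insert_and haS hJS.1 haT hli
      -- The number of realized extensions of `T` to `a` is the indicator of "or" plus the indicator
      -- of "and", i.e. the two terms of the recursion.
      by_cases hA : RealizesSigns x J (insert a S) T <;>
        by_cases hB : RealizesSigns x J (insert a S) (insert a T) <;>
        simp only [hA, hB, or_true, or_false, and_true, and_false, true_iff,
          false_iff] at hor hand <;>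
        simp [hA, hB, hor, hand]

theorem supports_flipSigns_iff {I T : Finset (Fin N)} :
    Supports (flipSigns T x) I ↔ RealizesSigns x I Iᶜ T := by
  have aux : ∀ (u : EuclideanSpace ℝ (Fin d)) (i : Fin N), inner ℝ u (flipSigns T x i) =
      if i ∈ T then inner ℝ u (x i) else -inner ℝ u (x i) := by
    intro u i
    unfold flipSigns
    split_ifs <;> simp
  constructor
  · rintro ⟨u, hu, hs⟩
    refine ⟨u, fun j hj => ?_, fun i hi => ?_⟩
    · have := hu j hj
      rw [aux] at this
      split_ifs at this <;> linarith
    · have := hs i (Finset.mem_compl.1 hi)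
      rw [aux] at this
      refine ⟨fun h => ?_, fun h => ?_⟩ <;> simp only [h, if_true, if_false] at this <;> linarith
  · rintro ⟨u, hu, hs⟩
    refine ⟨u, fun j hj => ?_, fun i hi => ?_⟩
    · rw [aux, hu j hj]
      simp
    · have := hs i (Finset.mem_compl.2 hi)
      rw [aux]
      split_ifs with h
      · exact this.1 h
      · linarith [this.2 h]

theorem card_supports_flipSigns (hx : InGeneralPosition x) {I : Finset (Fin N)}
    (hI : I.card ≤ d) :
    (Iᶜ.powerset.filter fun T => Supports (flipSigns T x) I).card =
      cellCount (N - I.card) (d - I.card) := by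
  rw [Finset.filter_congr fun T _ => supports_flipSigns_iff,
    card_realizesSigns hx _ I disjoint_compl_right hI, Finset.card_compl, Fintype.card_fin]

end

/-! ### Faces of the positive hull in general position -/

section

variable {d N : ℕ} {x : Fin N → EuclideanSpace ℝ (Fin d)}

/-- A convex cone with linear span `ℝ^d` which is not all of `ℝ^d` lies in a closed half-space. -/
theorem PointedCone.exists_inner_nonneg {C : PointedCone ℝ (EuclideanSpace ℝ (Fin d))}
    (hspan : Submodule.span ℝ (C : Set (EuclideanSpace ℝ (Fin d))) = ⊤) (hC : C ≠ ⊤) :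
    ∃ u : EuclideanSpace ℝ (Fin d), u ≠ 0 ∧ ∀ y ∈ C, 0 ≤ inner ℝ u y := by
  have hconv : Convex ℝ (C : Set (EuclideanSpace ℝ (Fin d))) := C.convex
  have hne : (interior (C : Set (EuclideanSpace ℝ (Fin d)))).Nonempty := by
    rw [hconv.interior_nonempty_iff_affineSpan_eq_top]
    have h0 : (0 : EuclideanSpace ℝ (Fin d)) ∈ (C : Set (EuclideanSpace ℝ (Fin d))) := C.zero_mem
    rw [← Set.insert_eq_of_mem h0]
    refine SetLike.coe_injective ?_
    rw [affineSpan_insert_zero, hspan]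
    simp
  -- A cone that is a neighbourhood of 0 contains a small positive multiple of every vector, hence
  -- everything.
  have h0 : (0 : EuclideanSpace ℝ (Fin d)) ∉ interior (C : Set (EuclideanSpace ℝ (Fin d))) := by
    intro h0
    refine hC (eq_top_iff.2 fun y _ => ?_)
    have hc : Tendsto (fun t : ℝ => t • y) (𝓝[>] 0) (𝓝 0) := by
      have : Continuous fun t : ℝ => t • y := by fun_prop
      simpa using (this.tendsto 0).mono_left nhdsWithin_le_nhds
    obtain ⟨t, ht, ht0⟩ :=
      ((hc.eventually (mem_interior_iff_mem_nhds.1 h0)).and self_mem_nhdsWithin).exists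
    have ht0 : (0 : ℝ) < t := ht0
    have : t⁻¹ • t • y ∈ C := PointedCone.smul_mem C (inv_nonneg.2 ht0.le) ht
    rwa [smul_smul, inv_mul_cancel₀ ht0.ne', one_smul] at this
  obtain ⟨f, hf⟩ := geometric_hahn_banach_open_point hconv.interior isOpen_interior h0
  simp only [map_zero] at hf
  have hcl : ∀ y ∈ C, f y ≤ 0 := by
    intro y hy
    have hy' : y ∈ closure (interior (C : Set (EuclideanSpace ℝ (Fin d)))) := by
      rw [hconv.closure_interior_eq_closure_of_nonempty_interior hne]
      exact subset_closure hy
    exact closure_minimal (fun z hz => (hf z hz).le)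
      (isClosed_le f.continuous continuous_const) hy'
  refine ⟨-(InnerProductSpace.toDual ℝ _).symm f, ?_, fun y hy => ?_⟩
  · obtain ⟨z, hz⟩ := hne
    intro h
    have hz := hf z hz
    rw [neg_eq_zero, LinearIsometryEquiv.map_eq_zero_iff] at h
    simp [h] at hz
  · rw [inner_neg_left, InnerProductSpace.toDual_symm_apply]
    linarith [hcl y hy]

/-- Fewer than `d` vectors lie on the hyperplane of a nonzero `u`, so they are independent. Tilting
`u` lifts those outside `I` off the hyperplane and keeps those in `I` on it. -/
theorem InGeneralPosition.supports_of_inner_nonneg (hx : InGeneralPosition x)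
    {I : Finset (Fin N)} {u : EuclideanSpace ℝ (Fin d)} (hu : u ≠ 0)
    (hI : ∀ i ∈ I, inner ℝ u (x i) = 0) (hpos : ∀ i, 0 ≤ inner ℝ u (x i)) : Supports x I := by
  classical
  set J : Finset (Fin N) := Finset.univ.filter fun i => inner ℝ u (x i) = 0 with hJ
  have hJd : J.card < d := by
    by_contra! h
    obtain ⟨K, hKJ, hK⟩ := Finset.exists_subset_card_eq h
    exact hu (eq_zero_of_inner_eq_zero (hx K hK.le) hK fun j hj => by simpa [hJ] using hKJ hj)
  obtain ⟨v, hv⟩ := exists_inner_eq_of_linearIndepOn (hx J hJd.le)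
    (fun i => if i ∈ I then 0 else 1)
  obtain ⟨t, ht, hts⟩ := exists_perturbation x u v
  refine ⟨u + t • v, fun i hi => ?_, fun i hi => ?_⟩
  · have := hv i (by simpa [hJ] using hI i hi)
    simp [inner_add_left, inner_smul_left, hI i hi, this, hi]
  · rcases (hpos i).eq_or_lt with h0 | h0
    · have := hv i (by simpa [hJ] using h0.symm)
      simp [inner_add_left, inner_smul_left, ← h0, this, hi, ht]
    · exact (hts i).1 h0

theorem mem_posHull_iff {y : EuclideanSpace ℝ (Fin d)} :
    y ∈ posHull x ↔ ∃ c : Fin N → ℝ, (∀ i, 0 ≤ c i) ∧ ∑ i, c i • x i = y := by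
  unfold posHull PointedCone.hull
  rw [Submodule.mem_span_range_iff_exists_fun]
  constructor
  · rintro ⟨c, hc⟩
    exact ⟨fun i => c i, fun i => (c i).2, hc⟩
  · rintro ⟨c, hc, h⟩
    exact ⟨fun i => ⟨c i, hc i⟩, h⟩

theorem apply_mem_posHull (i : Fin N) : x i ∈ posHull x :=
  PointedCone.subset_hull (Set.mem_range_self i)

theorem InGeneralPosition.span_posHull (hx : InGeneralPosition x) (hN : d ≤ N) :
    Submodule.span ℝ (posHull x : Set (EuclideanSpace ℝ (Fin d))) = ⊤ := by
  obtain ⟨K, -, hK⟩ := Finset.exists_subset_card_eq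
    (show d ≤ (Finset.univ : Finset (Fin N)).card by simpa using hN)
  have hs : Submodule.span ℝ (Set.range fun j : (K : Set (Fin N)) => x j) = ⊤ :=
    LinearIndependent.span_eq_top_of_card_eq_finrank' (hx K hK.le) (by simp [hK])
  rw [eq_top_iff, ← hs]
  refine Submodule.span_mono ?_
  rintro _ ⟨j, rfl⟩
  exact apply_mem_posHull _

/-- Vectors in general position whose positive hull is proper lie in an open half-space. -/
theorem InGeneralPosition.posHull_ne_top_iff (hx : InGeneralPosition x) (hN : d ≤ N)
    (hN0 : 0 < N) : posHull x ≠ ⊤ ↔ Supports x ∅ := by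
  constructor
  · intro h
    obtain ⟨u, hu, hpos⟩ := PointedCone.exists_inner_nonneg (hx.span_posHull hN) h
    exact hx.supports_of_inner_nonneg hu (by simp) fun i => hpos _ (apply_mem_posHull i)
  · rintro ⟨u, -, hu⟩ h
    have hm : -x ⟨0, hN0⟩ ∈ posHull x := h ▸ Submodule.mem_top
    obtain ⟨c, hc, hs⟩ := mem_posHull_iff.1 hm
    have h1 : 0 ≤ inner ℝ u (-x ⟨0, hN0⟩) := by
      rw [← hs, inner_sum]
      refine Finset.sum_nonneg fun i _ => ?_
      rw [inner_smul_right]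
      exact mul_nonneg (hc i) (hu i (by simp)).le
    have := hu ⟨0, hN0⟩ (by simp)
    rw [inner_neg_right] at h1
    linarith

/-- The cone generated by the vectors with index in `I`. -/
noncomputable def subHull (x : Fin N → EuclideanSpace ℝ (Fin d)) (I : Finset (Fin N)) :
    PointedCone ℝ (EuclideanSpace ℝ (Fin d)) :=
  PointedCone.hull ℝ (x '' (I : Set (Fin N)))

theorem apply_mem_subHull {I : Finset (Fin N)} {i : Fin N} (hi : i ∈ I) : x i ∈ subHull x I :=
  PointedCone.subset_hull (Set.mem_image_of_mem _ hi)

theorem span_subHull (I : Finset (Fin N)) :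
    Submodule.span ℝ (subHull x I : Set (EuclideanSpace ℝ (Fin d))) =
      Submodule.span ℝ (x '' (I : Set (Fin N))) :=
  Submodule.span_span_of_tower _ _ _

theorem InGeneralPosition.finrank_span_subHull (hx : InGeneralPosition x) {I : Finset (Fin N)}
    (hI : I.card ≤ d) :
    Module.finrank ℝ (Submodule.span ℝ (subHull x I : Set (EuclideanSpace ℝ (Fin d)))) =
      I.card := by
  rw [span_subHull, Set.image_eq_range, finrank_span_eq_card (hx I hI)]
  simp

theorem mem_subHull_iff {I : Finset (Fin N)} {u : EuclideanSpace ℝ (Fin d)}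
    (hu : ∀ i ∈ I, inner ℝ u (x i) = 0) (hpos : ∀ i ∉ I, 0 < inner ℝ u (x i))
    {y : EuclideanSpace ℝ (Fin d)} :
    y ∈ subHull x I ↔ y ∈ posHull x ∧ inner ℝ u y = 0 := by
  constructor
  · intro h
    refine ⟨Submodule.span_mono (Set.image_subset_range _ _) h, ?_⟩
    have : y ∈ Submodule.span ℝ (subHull x I : Set (EuclideanSpace ℝ (Fin d))) :=
      Submodule.subset_span h
    rw [span_subHull] at this
    have hle : Submodule.span ℝ (x '' (I : Set (Fin N))) ≤ LinearMap.ker (innerₛₗ ℝ u) := by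
      rw [Submodule.span_le]
      rintro _ ⟨j, hj, rfl⟩
      exact hu j hj
    exact hle this
  · rintro ⟨hy, h0⟩
    obtain ⟨c, hc, rfl⟩ := mem_posHull_iff.1 hy
    rw [inner_sum, Finset.sum_eq_zero_iff_of_nonneg] at h0
    · refine sum_mem fun i _ => ?_
      by_cases hi : i ∈ I
      · exact PointedCone.smul_mem _ (hc i) (apply_mem_subHull hi)
      · have := h0 i (Finset.mem_univ _)
        rw [inner_smul_right] at this
        rw [(mul_eq_zero.1 this).resolve_right (hpos i hi).ne', zero_smul]
        exact Submodule.zero_mem _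
    · intro i _
      rw [inner_smul_right]
      refine mul_nonneg (hc i) ?_
      by_cases hi : i ∈ I
      · exact (hu i hi).ge
      · exact (hpos i hi).le

theorem isFaceOf_subHull {I : Finset (Fin N)} (hI : Supports x I) :
    (subHull x I).IsFaceOf (posHull x) := by
  obtain ⟨u, hu, hpos⟩ := hI
  have hnn : ∀ y ∈ posHull x, 0 ≤ inner ℝ u y := by
    intro y hy
    obtain ⟨c, hc, rfl⟩ := mem_posHull_iff.1 hy
    rw [inner_sum]
    refine Finset.sum_nonneg fun i _ => ?_
    rw [inner_smul_right]
    refine mul_nonneg (hc i) ?_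
    by_cases hi : i ∈ I
    · exact (hu i hi).ge
    · exact (hpos i hi).le
  refine .of_mem_of_add_mem_left (fun y hy => ((mem_subHull_iff hu hpos).1 hy).1) ?_
  intro y z hy hz hyz
  rw [mem_subHull_iff hu hpos, inner_add_right] at hyz
  exact (mem_subHull_iff hu hpos).2 ⟨hy, by linarith [hnn y hy, hnn z hz]⟩

theorem Supports.apply_mem_subHull_iff {I : Finset (Fin N)} (hI : Supports x I) {i : Fin N} :
    x i ∈ subHull x I ↔ i ∈ I := by
  refine ⟨fun h => ?_, apply_mem_subHull⟩
  obtain ⟨u, hu, hpos⟩ := hI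
  by_contra hi
  exact (hpos i hi).ne' ((mem_subHull_iff hu hpos).1 h).2

/-- If a nonnegative combination lies in a face, so does every generator with positive coefficient;
a face is therefore generated by the generators it contains. -/
theorem PointedCone.IsFaceOf.eq_subHull {F : PointedCone ℝ (EuclideanSpace ℝ (Fin d))}
    (hF : F.IsFaceOf (posHull x)) {I : Finset (Fin N)} (hI : ∀ i, i ∈ I ↔ x i ∈ F) :
    F = subHull x I := by
  apply le_antisymm
  · intro y hy
    obtain ⟨c, hc, rfl⟩ := mem_posHull_iff.1 (hF.le hy)
    refine sum_mem fun i _ => ?_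
    rcases (hc i).eq_or_lt with h0 | h0
    · rw [← h0, zero_smul]
      exact Submodule.zero_mem _
    · refine PointedCone.smul_mem _ (hc i) (apply_mem_subHull ((hI i).2 ?_))
      exact hF.mem_of_sum_smul_mem apply_mem_posHull hc hy i h0
  · refine Submodule.span_le.2 ?_
    rintro _ ⟨i, hi, rfl⟩
    exact (hI i).1 hi

/-- Every lower-dimensional face of the positive hull of vectors in general position is generated
by exactly as many of them as its dimension, and is exposed. -/
theorem InGeneralPosition.exists_eq_subHull (hx : InGeneralPosition x) (hN : d ≤ N)
    {F : PointedCone ℝ (EuclideanSpace ℝ (Fin d))} (hF : F.IsFaceOf (posHull x))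
    (hk : Module.finrank ℝ (Submodule.span ℝ (F : Set (EuclideanSpace ℝ (Fin d)))) < d) :
    ∃ I : Finset (Fin N), I.card =
      Module.finrank ℝ (Submodule.span ℝ (F : Set (EuclideanSpace ℝ (Fin d)))) ∧
      Supports x I ∧ F = subHull x I := by
  classical
  set I : Finset (Fin N) := Finset.univ.filter fun i => x i ∈ F
  have hI : ∀ i, i ∈ I ↔ x i ∈ F := by simp [I]
  have hFI := hF.eq_subHull hI
  -- With more than `d` generators, `F` would contain `d` independent ones, contradicting its
  -- dimension.
  have hId : I.card ≤ d := by
    by_contra! h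
    obtain ⟨K, hKI, hK⟩ := Finset.exists_subset_card_eq h.le
    have h1 := hx.finrank_span_subHull hK.le
    have h2 := Submodule.finrank_mono (R := ℝ) (Submodule.span_mono (R := ℝ)
      (show (subHull x K : Set (EuclideanSpace ℝ (Fin d))) ⊆ F by
        rw [hFI]
        exact Submodule.span_mono (Set.image_mono (by exact_mod_cast hKI))))
    omega
  have hcard : I.card =
      Module.finrank ℝ (Submodule.span ℝ (F : Set (EuclideanSpace ℝ (Fin d)))) := by
    rw [hFI, hx.finrank_span_subHull hId]
  refine ⟨I, hcard, ?_, hFI⟩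
  obtain ⟨i, -, hi⟩ : ∃ i ∈ Finset.univ, i ∉ I := by
    refine Finset.exists_mem_notMem_of_card_lt_card ?_
    rw [hcard, Finset.card_univ, Fintype.card_fin]
    omega
  -- A functional nonnegative on the hull and on `-F` vanishes on `F`. This sum is proper: `-x i = c
  -- - g` with `g` in `F` gives `x i + c = g`, so the face property would put `x i` into `F`.
  set C : PointedCone ℝ (EuclideanSpace ℝ (Fin d)) :=
    posHull x ⊔ PointedCone.map (-LinearMap.id) F
  have hC : C ≠ ⊤ := by
    intro h
    have hm : -x i ∈ C := h ▸ Submodule.mem_top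
    obtain ⟨c, hc, f, hf, hcf⟩ := Submodule.mem_sup.1 hm
    obtain ⟨g, hg, rfl⟩ := PointedCone.mem_map.1 hf
    refine hi ((hI i).2 (hF.mem_of_add_mem_left (apply_mem_posHull i) hc ?_))
    have : x i + c = g := by
      simp only [LinearMap.neg_apply, LinearMap.id_apply] at hcf
      calc x i + c = x i + (c + -g) + g := by abel
        _ = g := by rw [hcf]; abel
    rwa [this]
  obtain ⟨u, hu, hpos⟩ := PointedCone.exists_inner_nonneg (C := C) (by
    rw [eq_top_iff, ← hx.span_posHull hN]
    exact Submodule.span_mono (SetLike.coe_subset_coe.2 le_sup_left)) hC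
  have hpos' : ∀ i, 0 ≤ inner ℝ u (x i) := fun i =>
    hpos _ (SetLike.le_def.1 le_sup_left (apply_mem_posHull i))
  refine hx.supports_of_inner_nonneg hu (fun j hj => le_antisymm ?_ (hpos' j)) hpos'
  have : -x j ∈ C := SetLike.le_def.1 le_sup_right
    (PointedCone.mem_map.2 ⟨x j, (hI j).1 hj, by simp⟩)
  have := hpos _ this
  rw [inner_neg_right] at this
  linarith

theorem InGeneralPosition.faceNumber_posHull (hx : InGeneralPosition x) (hN : d ≤ N) {k : ℕ}
    (hk : k < d) :
    faceNumber k (posHull x) =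
      ((Finset.powersetCard k Finset.univ).filter (Supports x)).card := by
  rw [← Set.ncard_coe_finset, faceNumber,
    ← Set.InjOn.ncard_image (f := subHull x)
      (s := ((Finset.powersetCard k Finset.univ).filter (Supports x) : Finset (Finset (Fin N))))]
  · congr 1
    ext F
    simp only [Set.mem_ofPred_eq, Set.mem_image, Finset.mem_coe, Finset.mem_filter,
      Finset.mem_powersetCard_univ]
    constructor
    · rintro ⟨hF, hFk⟩
      obtain ⟨I, hI, hs, rfl⟩ := hx.exists_eq_subHull hN hF (hFk ▸ hk)
      exact ⟨I, ⟨hI.trans hFk, hs⟩, rfl⟩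
    · rintro ⟨I, ⟨hI, hs⟩, rfl⟩
      exact ⟨isFaceOf_subHull hs, by rw [hx.finrank_span_subHull (by omega), hI]⟩
  · intro I hI J hJ h
    simp only [Finset.mem_coe, Finset.mem_filter] at hI hJ
    ext i
    rw [← hI.2.apply_mem_subHull_iff, ← hJ.2.apply_mem_subHull_iff]
    rw [h]

/-- A nonzero functional supporting a proper index set is nonnegative on all vectors, so it can be
tilted to be strictly positive. -/
theorem Supports.empty {I : Finset (Fin N)} (hx : InGeneralPosition x) (hI : Supports x I)
    (hIN : I.card < N) : Supports x ∅ := by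
  obtain ⟨u, hu, hpos⟩ := hI
  refine hx.supports_of_inner_nonneg (u := u) ?_ (by simp) fun i => ?_
  · rintro rfl
    obtain ⟨i, -, hi⟩ : ∃ i ∈ Finset.univ, i ∉ I := by
      refine Finset.exists_mem_notMem_of_card_lt_card ?_
      rwa [Finset.card_univ, Fintype.card_fin]
    simpa using hpos i hi
  · by_cases hi : i ∈ I
    · exact (hu i hi).ge
    · exact (hpos i hi).le

end

/-! ### Wendel's theorem and the expected number of faces -/

section

variable {d N : ℕ}

/-- The event is a countable union of closed sets: bound the norm of `u` by `M` and the positive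
values below by `1 / M`, then project along a compact ball. -/
theorem measurableSet_supports (I : Finset (Fin N)) :
    MeasurableSet {x : Fin N → EuclideanSpace ℝ (Fin d) | Supports x I} := by
  have hcl : ∀ M : ℕ, IsClosed {x : Fin N → EuclideanSpace ℝ (Fin d) |
      ∃ u : EuclideanSpace ℝ (Fin d), ‖u‖ ≤ M ∧ (∀ i ∈ I, inner ℝ u (x i) = 0) ∧
        ∀ i ∉ I, 1 ≤ M * inner ℝ u (x i)} := by
    intro M
    have : CompactSpace (Metric.closedBall (0 : EuclideanSpace ℝ (Fin d)) M) :=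
      isCompact_iff_compactSpace.1 (isCompact_closedBall _ _)
    have hK : IsClosed {p : Metric.closedBall (0 : EuclideanSpace ℝ (Fin d)) M ×
        (Fin N → EuclideanSpace ℝ (Fin d)) |
        (∀ i ∈ I, inner ℝ (p.1 : EuclideanSpace ℝ (Fin d)) (p.2 i) = 0) ∧
          ∀ i ∉ I, 1 ≤ M * inner ℝ (p.1 : EuclideanSpace ℝ (Fin d)) (p.2 i)} := by
      simp only [Set.ofPred_and, Set.ofPred_forall]
      refine (isClosed_iInter fun i => isClosed_iInter fun _ => ?_).inter
        (isClosed_iInter fun i => isClosed_iInter fun _ => ?_)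
      · exact isClosed_eq (by fun_prop) continuous_const
      · exact isClosed_le continuous_const (by fun_prop)
    convert isClosedMap_snd_of_compactSpace _ hK using 1
    ext x
    simp only [Set.mem_ofPred_eq, Set.mem_image, Prod.exists, exists_eq_right, Subtype.exists,
      mem_closedBall_zero_iff, exists_prop]
  convert MeasurableSet.iUnion fun M => (hcl M).measurableSet using 1
  ext x
  simp only [Set.mem_ofPred_eq, Set.mem_iUnion]
  constructor
  · rintro ⟨u, hu, hpos⟩
    have h1 : ∀ᶠ M : ℕ in atTop, ‖u‖ ≤ M := tendsto_natCast_atTop_atTop.eventually_ge_atTop _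
    have h2 : ∀ᶠ M : ℕ in atTop, ∀ i, i ∉ I → 1 ≤ (M : ℝ) * inner ℝ u (x i) := by
      rw [eventually_all]
      intro i
      by_cases hi : i ∈ I
      · exact Eventually.of_forall fun M h => absurd hi h
      · filter_upwards [(tendsto_natCast_atTop_atTop.atTop_mul_const
          (hpos i hi)).eventually_ge_atTop 1] with M hM _ using hM
    obtain ⟨M, hM, hM'⟩ := (h1.and h2).exists
    exact ⟨M, u, hM, hu, hM'⟩
  · rintro ⟨M, u, -, hu, hpos⟩
    exact ⟨u, hu, fun i hi => pos_of_mul_pos_right (zero_lt_one.trans_le (hpos i hi))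
      M.cast_nonneg⟩

section RandomVectors

variable {φ : Measure (EuclideanSpace ℝ (Fin d))} {Ω : Type*} [MeasurableSpace Ω] {P : Measure Ω}
  [IsProbabilityMeasure P] {X : Fin N → Ω → EuclideanSpace ℝ (Fin d)}

theorem IsEvenGeneric.measure_submodule_eq_zero (hφ : IsEvenGeneric φ)
    {W : Submodule ℝ (EuclideanSpace ℝ (Fin d))} (hW : W ≠ ⊤) :
    φ (W : Set (EuclideanSpace ℝ (Fin d))) = 0 := by
  obtain ⟨u, hu, hu0⟩ := Submodule.exists_mem_ne_zero_of_ne_bot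
    (mt Submodule.orthogonal_eq_bot_iff.1 hW)
  refine measure_mono_null (fun y hy => ?_) (hφ.hyperplane u hu0)
  exact Submodule.inner_left_of_mem_orthogonal hy hu

/-- Vectors are added one at a time: the new one is independent of the earlier ones, whose span is a
proper subspace and hence a null set for `φ`. -/
theorem ae_linearIndepOn (hφ : IsEvenGeneric φ) (hmeas : ∀ i, Measurable (X i))
    (hlaw : ∀ i, P.map (X i) = φ) (hindep : iIndepFun X P) (J : Finset (Fin N)) :
    J.card ≤ d → ∀ᵐ ω ∂P, LinearIndepOn ℝ (fun i => X i ω) (J : Set (Fin N)) := by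
  have := hφ.isProbabilityMeasure
  induction J using Finset.induction_on with
  | empty => simp
  | insert a J ha ih =>
    intro hJ
    rw [Finset.card_insert_of_notMem ha] at hJ
    have hind : IndepFun (fun ω (j : J) => X j ω) (X a) P :=
      (hindep.indepFun_finset J {a} (by simpa using ha) hmeas).comp measurable_id
        (measurable_pi_apply (⟨a, by simp⟩ : ({a} : Finset (Fin N))))
    have hmJ : Measurable (fun ω (j : J) => X j ω) := measurable_pi_lambda _ fun j => hmeas j
    have hpair := (indepFun_iff_map_prod_eq_prod_map_map hmJ.aemeasurable
      (hmeas a).aemeasurable).1 hind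
    rw [hlaw] at hpair
    set ν := P.map (fun ω (j : J) => X j ω) with hν
    have : IsProbabilityMeasure ν := Measure.isProbabilityMeasure_map hmJ.aemeasurable
    set B : Set ((J → EuclideanSpace ℝ (Fin d)) × EuclideanSpace ℝ (Fin d)) :=
      {p | LinearIndependent ℝ p.1 ∧
        ¬ LinearIndependent ℝ (fun o : Option J => o.elim p.2 p.1)} with hB
    have hBm : MeasurableSet B := by
      refine (isOpen_setOfPred_linearIndependent.preimage continuous_fst).measurableSet.inter
        (IsOpen.measurableSet (?_ : IsOpen _)).compl
      refine isOpen_setOfPred_linearIndependent.preimage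
        (f := fun p : (J → EuclideanSpace ℝ (Fin d)) × EuclideanSpace ℝ (Fin d) =>
          fun o : Option J => o.elim p.2 p.1) ?_
      refine continuous_pi fun o => ?_
      cases o with
      | none => exact continuous_snd
      | some j => exact (continuous_apply j).comp continuous_fst
    -- By Fubini it suffices that each section of `B` lies in the span of fewer than `d` vectors.
    have hB0 : (ν.prod φ) B = 0 := by
      rw [Measure.measure_prod_null hBm]
      refine Eventually.of_forall fun z => ?_
      have hW : Submodule.span ℝ (Set.range z) ≠ ⊤ := by
        intro h
        have h1 := finrank_range_le_card (R := ℝ) z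
        rw [Set.finrank, h, finrank_top, finrank_euclideanSpace_fin, Fintype.card_coe] at h1
        omega
      refine measure_mono_null (fun y hy => ?_) (hφ.measure_submodule_eq_zero hW)
      obtain ⟨hz, hy⟩ := hy
      by_contra hyz
      exact hy (linearIndependent_option.2 ⟨hz, hyz⟩)
    rw [← hpair, Measure.map_apply (hmJ.prodMk (hmeas a)) hBm] at hB0
    filter_upwards [ih (by omega), measure_eq_zero_iff_ae_notMem.1 hB0] with ω h1 h2
    have h3 : LinearIndependent ℝ (fun o : Option J => o.elim (X a ω) (fun j : J => X j ω)) := by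
      by_contra h
      exact h2 ⟨h1, h⟩
    rw [Finset.coe_insert]
    refine LinearIndepOn.insert h1 ?_
    have := (linearIndependent_option.1 h3).2
    rw [Set.image_eq_range]
    exact this

theorem ae_inGeneralPosition (hφ : IsEvenGeneric φ) (hmeas : ∀ i, Measurable (X i))
    (hlaw : ∀ i, P.map (X i) = φ) (hindep : iIndepFun X P) :
    ∀ᵐ ω ∂P, InGeneralPosition (fun i => X i ω) := by
  unfold InGeneralPosition
  rw [ae_all_iff]
  intro J
  by_cases hJ : J.card ≤ d
  · filter_upwards [ae_linearIndepOn hφ hmeas hlaw hindep J hJ] with ω h _ using h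
  · exact Eventually.of_forall fun ω h => absurd h hJ

theorem IsEvenGeneric.measurePreserving_flipSigns (hφ : IsEvenGeneric φ) (T : Finset (Fin N)) :
    MeasurePreserving (flipSigns T) (Measure.pi fun _ : Fin N => φ)
      (Measure.pi fun _ : Fin N => φ) := by
  have := hφ.isProbabilityMeasure
  have h : ∀ i : Fin N, MeasurePreserving
      (fun y : EuclideanSpace ℝ (Fin d) => if i ∈ T then y else -y) φ φ := by
    intro i
    split_ifs
    · exact MeasurePreserving.id φ
    · exact ⟨measurable_neg, hφ.even⟩
  exact measurePreserving_pi (fun _ => φ) (fun _ => φ) h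

/-- The fraction `cellCount n m / 2 ^ n` of realized sign patterns. -/
noncomputable def cellProb (n m : ℕ) : ℝ := cellCount n m / 2 ^ n

theorem cellCount_succ_pos (n : ℕ) : ∀ m, 0 < cellCount n (m + 1) := by
  induction n with
  | zero => exact fun m => Nat.one_pos
  | succ n ih => exact fun m => Nat.add_pos_left (ih m) _

theorem cellProb_pos (n : ℕ) {m : ℕ} (hm : 0 < m) : 0 < cellProb n m := by
  obtain ⟨m, rfl⟩ := Nat.exists_eq_succ_of_ne_zero hm.ne'
  exact div_pos (Nat.cast_pos.2 (cellCount_succ_pos n m)) (by positivity)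

/-- **Wendel's theorem**, relative to the linear span of the vectors with index in `I`. -/
theorem IsEvenGeneric.measureReal_supports (hφ : IsEvenGeneric φ) {I : Finset (Fin N)}
    (hI : I.card ≤ d) :
    (Measure.pi fun _ : Fin N => φ).real {x | Supports x I} =
      cellProb (N - I.card) (d - I.card) := by
  have := hφ.isProbabilityMeasure
  set μ := Measure.pi fun _ : Fin N => φ with hμ
  have hmap : ∀ i : Fin N, μ.map (fun x => x i) = φ := fun i =>
    (measurePreserving_eval (fun _ : Fin N => φ) i).map_eq
  have hind : iIndepFun (fun (i : Fin N) (x : Fin N → EuclideanSpace ℝ (Fin d)) => x i) μ :=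
    iIndepFun_pi (μ := fun _ : Fin N => φ) (X := fun _ => id) fun _ => aemeasurable_id
  have hgp : ∀ᵐ x ∂μ, InGeneralPosition x :=
    ae_inGeneralPosition hφ (fun i => measurable_pi_apply i) hmap hind
  have hT : ∀ T : Finset (Fin N),
      μ.real {x | Supports x I} = ∫ x, if Supports (flipSigns T x) I then (1 : ℝ) else 0 ∂μ := by
    intro T
    have hp := hφ.measurePreserving_flipSigns T
    have hm := hp.measurable (measurableSet_supports I)
    rw [← hp.measureReal_preimage (measurableSet_supports I).nullMeasurableSet,
      ← integral_indicator_one hm]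
    refine integral_congr_ae (Eventually.of_forall fun x => ?_)
    by_cases h : Supports (flipSigns T x) I <;> simp [Set.indicator, h]
  -- All flips outside `I` give the same probability, while the number of successful flips is almost
  -- surely constant.
  have hsum : ∑ T ∈ Iᶜ.powerset, μ.real {x | Supports x I} =
      ∫ _, (cellCount (N - I.card) (d - I.card) : ℝ) ∂μ := by
    rw [Finset.sum_congr rfl fun T _ => hT T, ← integral_finsetSum]
    · refine integral_congr_ae ?_
      filter_upwards [hgp] with x hx
      rw [← card_supports_flipSigns hx hI, Finset.card_filter]
      push_cast
      rfl
    · intro T _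
      have hm := (hφ.measurePreserving_flipSigns T).measurable (measurableSet_supports I)
      refine ((integrable_const (1 : ℝ)).indicator hm).congr (Eventually.of_forall fun x => ?_)
      by_cases h : Supports (flipSigns T x) I <;> simp [Set.indicator, h]
  rw [Finset.sum_const, Finset.card_powerset, Finset.card_compl, Fintype.card_fin] at hsum
  rw [cellProb, eq_div_iff (by positivity), mul_comm]
  simpa using hsum

omit [IsProbabilityMeasure P] in
theorem measureReal_supports (hφ : IsEvenGeneric φ) (hmeas : ∀ i, Measurable (X i))
    (hlaw : ∀ i, P.map (X i) = φ) (hindep : iIndepFun X P) {I : Finset (Fin N)}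
    (hI : I.card ≤ d) :
    P.real {ω | Supports (fun i => X i ω) I} = cellProb (N - I.card) (d - I.card) := by
  have h := hindep.map_fun_eq_pi_map fun i => (hmeas i).aemeasurable
  simp only [hlaw] at h
  rw [← hφ.measureReal_supports hI, ← h,
    map_measureReal_apply (measurable_pi_lambda _ hmeas) (measurableSet_supports I)]
  rfl

theorem posHullProper_ae_eq (hφ : IsEvenGeneric φ) (hmeas : ∀ i, Measurable (X i))
    (hlaw : ∀ i, P.map (X i) = φ) (hindep : iIndepFun X P) (hN : d < N) :
    posHullProper X =ᵐ[P] {ω | Supports (fun i => X i ω) ∅} := by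
  rw [Filter.eventuallyEq_set]
  filter_upwards [ae_inGeneralPosition hφ hmeas hlaw hindep] with ω h
  exact h.posHull_ne_top_iff hN.le (by omega)

/-- **Wendel's theorem**: the probability that the positive hull is proper. -/
theorem measureReal_posHullProper (hφ : IsEvenGeneric φ) (hmeas : ∀ i, Measurable (X i))
    (hlaw : ∀ i, P.map (X i) = φ) (hindep : iIndepFun X P) (hN : d < N) :
    P.real (posHullProper X) = cellProb N d := by
  rw [measureReal_congr (posHullProper_ae_eq hφ hmeas hlaw hindep hN),
    measureReal_supports hφ hmeas hlaw hindep (by simp)]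
  simp

theorem faceNumber_ae_eq (hφ : IsEvenGeneric φ) (hmeas : ∀ i, Measurable (X i))
    (hlaw : ∀ i, P.map (X i) = φ) (hindep : iIndepFun X P) (hN : d < N) {k : ℕ} (hk : k < d) :
    (fun ω => (faceNumber k (posHull fun i => X i ω) : ℝ)) =ᵐ[P]
      fun ω => ∑ I ∈ Finset.powersetCard k Finset.univ,
        {ω | Supports (fun i => X i ω) I}.indicator (fun _ => (1 : ℝ)) ω := by
  filter_upwards [ae_inGeneralPosition hφ hmeas hlaw hindep] with ω h
  rw [h.faceNumber_posHull hN.le hk, Finset.card_filter]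
  push_cast
  refine Finset.sum_congr rfl fun I _ => ?_
  by_cases h : Supports (fun i => X i ω) I <;> simp [Set.indicator, h]

theorem measurableSet_supports_comp (hmeas : ∀ i, Measurable (X i)) (I : Finset (Fin N)) :
    MeasurableSet {ω | Supports (fun i => X i ω) I} :=
  (measurable_pi_lambda _ hmeas) (measurableSet_supports I)

theorem integrable_faceNumber (hφ : IsEvenGeneric φ) (hmeas : ∀ i, Measurable (X i))
    (hlaw : ∀ i, P.map (X i) = φ) (hindep : iIndepFun X P) (hN : d < N) {k : ℕ} (hk : k < d) :
    Integrable (fun ω => (faceNumber k (posHull fun i => X i ω) : ℝ)) P := by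
  refine Integrable.congr ?_ (faceNumber_ae_eq hφ hmeas hlaw hindep hN hk).symm
  exact integrable_finsetSum _ fun I _ =>
    (integrable_const (1 : ℝ)).indicator (measurableSet_supports_comp hmeas I)

theorem measure_posHullProper_ne_zero (hφ : IsEvenGeneric φ) (hmeas : ∀ i, Measurable (X i))
    (hlaw : ∀ i, P.map (X i) = φ) (hindep : iIndepFun X P) (hd : 0 < d) (hN : d < N) :
    P (posHullProper X) ≠ 0 := by
  intro h
  have h1 := measureReal_posHullProper hφ hmeas hlaw hindep hN
  rw [Measure.real, h, ENNReal.toReal_zero] at h1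
  exact (cellProb_pos N hd).ne h1

theorem integrable_faceNumber_coverEfron (hφ : IsEvenGeneric φ) (hmeas : ∀ i, Measurable (X i))
    (hlaw : ∀ i, P.map (X i) = φ) (hindep : iIndepFun X P) (hN : d < N) {k : ℕ} (hk : k < d) :
    Integrable (fun ω => (faceNumber k (posHull fun i => X i ω) : ℝ)) (coverEfronMeasure P X) :=
  (integrable_faceNumber hφ hmeas hlaw hindep hN hk).restrict.smul_measure
    (ENNReal.inv_ne_top.2 (measure_posHullProper_ne_zero hφ hmeas hlaw hindep (by omega) hN))

/-- The expected number of `k`-faces of the Cover–Efron cone. -/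
theorem expectedFaceNumber_eq (hφ : IsEvenGeneric φ) (hmeas : ∀ i, Measurable (X i))
    (hlaw : ∀ i, P.map (X i) = φ) (hindep : iIndepFun X P) (hN : d < N) {k : ℕ} (hk : k < d) :
    expectedFaceNumber P X k =
      N.choose k * (cellProb (N - k) (d - k) / cellProb N d) := by
  have hae := faceNumber_ae_eq hφ hmeas hlaw hindep hN hk
  have hint : ∫ ω, (faceNumber k (posHull fun i => X i ω) : ℝ) ∂P =
      N.choose k * cellProb (N - k) (d - k) := by
    rw [integral_congr_ae hae, integral_finsetSum]
    · rw [Finset.sum_congr rfl (g := fun _ => cellProb (N - k) (d - k))]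
      · simp
      · intro I hI
        rw [Finset.mem_powersetCard_univ] at hI
        have := measureReal_supports hφ hmeas hlaw hindep (I := I) (by omega)
        rw [hI] at this
        rw [← this, integral_indicator_const _ (measurableSet_supports_comp hmeas I)]
        simp
    · exact fun I _ =>
        (integrable_const (1 : ℝ)).indicator (measurableSet_supports_comp hmeas I)
  -- Outside the conditioning event no index set of size `k` is supporting, so nothing is lost by
  -- integrating over all of `Ω`.
  have hset : ∫ ω in posHullProper X, (faceNumber k (posHull fun i => X i ω) : ℝ) ∂P =
      ∫ ω, (faceNumber k (posHull fun i => X i ω) : ℝ) ∂P := by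
    rw [setIntegral_congr_set (posHullProper_ae_eq hφ hmeas hlaw hindep hN)]
    refine setIntegral_eq_integral_of_ae_compl_eq_zero ?_
    filter_upwards [ae_inGeneralPosition hφ hmeas hlaw hindep] with ω h hω
    rw [h.faceNumber_posHull hN.le hk, Nat.cast_eq_zero, Finset.card_eq_zero,
      Finset.filter_eq_empty_iff]
    intro I hI hs
    rw [Finset.mem_powersetCard_univ] at hI
    exact hω (hs.empty h (by omega))
  rw [expectedFaceNumber, coverEfronMeasure, ProbabilityTheory.cond, integral_smul_measure, hset,
    hint, ENNReal.toReal_inv, ← Measure.real, measureReal_posHullProper hφ hmeas hlaw hindep hN,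
    smul_eq_mul]
  ring

end RandomVectors

end

/-! ### Random walk representation and the central limit theorem -/

section

theorem cellProb_succ_zero (n : ℕ) : cellProb (n + 1) 0 = 0 := by
  simp [cellProb, cellCount]

theorem cellProb_succ_succ (n m : ℕ) :
    cellProb (n + 1) (m + 1) = (cellProb n m + cellProb n (m + 1)) / 2 := by
  simp only [cellProb, cellCount]
  push_cast
  rw [pow_succ]
  field_simp
  ring

/-- The law of a fair sign. -/
noncomputable def fairSign : Measure ℝ :=
  bernoulliMeasure 1 (-1) ⟨1 / 2, by norm_num, by norm_num⟩

instance : IsProbabilityMeasure fairSign := by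
  unfold fairSign
  infer_instance

theorem integral_fairSign (f : ℝ → ℝ) : ∫ x, f x ∂fairSign = (f 1 + f (-1)) / 2 := by
  rw [fairSign, integral_bernoulliMeasure]
  simp only [smul_eq_mul]
  ring

theorem fairSign_real_apply {s : Set ℝ} (hs : MeasurableSet s) :
    fairSign.real s = (s.indicator 1 1 + s.indicator 1 (-1)) / 2 := by
  rw [← integral_indicator_one hs, integral_fairSign]

section Walk

variable {Ω : Type*} [MeasurableSpace Ω] {P : Measure Ω} [IsProbabilityMeasure P]
  {ξ : ℕ → Ω → ℝ}

/-- Condition on the last step, which is independent of the earlier sum and equals 1 or -1 with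
probability 1/2 each. -/
theorem measureReal_walk_succ (hmeas : ∀ i, Measurable (ξ i)) (hlaw : ∀ i, HasLaw (ξ i) fairSign P)
    (hindep : iIndepFun ξ P) (n : ℕ) (t : ℝ) :
    P.real {ω | ∑ i ∈ Finset.range (n + 1), ξ i ω < t} =
      (P.real {ω | ∑ i ∈ Finset.range n, ξ i ω < t - 1} +
        P.real {ω | ∑ i ∈ Finset.range n, ξ i ω < t + 1}) / 2 := by
  have hS : Measurable fun ω => ∑ i ∈ Finset.range n, ξ i ω :=
    Finset.measurable_fun_sum _ fun i _ => hmeas i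
  have hind : IndepFun (fun ω => ∑ i ∈ Finset.range n, ξ i ω) (ξ n) P := by
    convert hindep.indepFun_finsetSum_of_notMem hmeas (s := Finset.range n) (i := n) (by simp)
      using 1
    ext ω
    simp
  have hval : ∀ c : ℝ, P.real (ξ n ⁻¹' {c}) =
      (({c} : Set ℝ).indicator 1 1 + ({c} : Set ℝ).indicator 1 (-1)) / 2 := by
    intro c
    rw [← map_measureReal_apply (hmeas n) (measurableSet_singleton c), (hlaw n).map_eq,
      fairSign_real_apply (measurableSet_singleton c)]
  have h1 : P.real (ξ n ⁻¹' {1}) = 1 / 2 := by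
    rw [hval]
    norm_num [Set.indicator]
  have h2 : P.real (ξ n ⁻¹' {-1}) = 1 / 2 := by
    rw [hval]
    norm_num [Set.indicator]
  have hae : ∀ᵐ ω ∂P, ξ n ω = 1 ∨ ξ n ω = -1 := by
    have hm : MeasurableSet ({1, -1} : Set ℝ)ᶜ := (Set.toFinite _).measurableSet.compl
    have h0 : P.real (ξ n ⁻¹' ({1, -1} : Set ℝ)ᶜ) = 0 := by
      rw [← map_measureReal_apply (hmeas n) hm, (hlaw n).map_eq, fairSign_real_apply hm]
      simp
    rw [measureReal_eq_zero_iff, measure_eq_zero_iff_ae_notMem] at h0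
    filter_upwards [h0] with ω hω
    by_contra! h
    exact hω (by simp [h])
  have hset : {ω | ∑ i ∈ Finset.range (n + 1), ξ i ω < t} =ᵐ[P]
      (((fun ω => ∑ i ∈ Finset.range n, ξ i ω) ⁻¹' Set.Iio (t - 1) ∩ ξ n ⁻¹' {1}) ∪
        ((fun ω => ∑ i ∈ Finset.range n, ξ i ω) ⁻¹' Set.Iio (t + 1) ∩ ξ n ⁻¹' {-1}) : Set Ω) := by
    rw [Filter.eventuallyEq_set]
    filter_upwards [hae] with ω hω
    simp only [Finset.sum_range_succ, Set.mem_union, Set.mem_inter_iff,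
      Set.mem_preimage, Set.mem_Iio, Set.mem_singleton_iff]
    rcases hω with h | h <;> rw [h]
    · norm_num [lt_sub_iff_add_lt]
    · norm_num [lt_sub_iff_add_lt, sub_lt_iff_lt_add, ← sub_eq_add_neg]
  rw [measureReal_congr hset, measureReal_union]
  · simp only [Measure.real]
    rw [hind.measure_inter_preimage_eq_mul _ _ measurableSet_Iio (measurableSet_singleton _),
      hind.measure_inter_preimage_eq_mul _ _ measurableSet_Iio (measurableSet_singleton _),
      ENNReal.toReal_mul, ENNReal.toReal_mul]
    simp only [← measureReal_def]
    rw [h1, h2]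
    simp only [Set.preimage, Set.mem_Iio]
    ring
  · rw [Set.disjoint_left]
    rintro ω ⟨-, h⟩ ⟨-, h'⟩
    rw [Set.mem_preimage, Set.mem_singleton_iff] at h h'
    linarith
  · exact (hS measurableSet_Iio).inter (hmeas n (measurableSet_singleton _))

/-- Both sides satisfy the same recursion. The index shift is needed because `cellCount 0 0 = 1`:
the match starts with one hyperplane and zero steps. -/
theorem cellProb_eq_measureReal_walk (hmeas : ∀ i, Measurable (ξ i))
    (hlaw : ∀ i, HasLaw (ξ i) fairSign P) (hindep : iIndepFun ξ P) (n : ℕ) :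
    ∀ m : ℕ, cellProb (n + 1) m =
      P.real {ω | ∑ i ∈ Finset.range n, ξ i ω < 2 * (m : ℝ) - n} := by
  induction n with
  | zero =>
    intro m
    rcases m with _ | m
    · simp [cellProb_succ_zero]
    · have : (0 : ℝ) < 2 * (m + 1) := by positivity
      simp [cellProb, cellCount, this]
  | succ n ih =>
    intro m
    rw [measureReal_walk_succ hmeas hlaw hindep]
    rcases m with _ | m
    -- At `m = 0` both neighbouring thresholds are at most `-n`, and the walk never goes below that.
    · have h2 := ih 0
      rw [cellProb_succ_zero] at h2
      have h1 : P.real {ω | ∑ i ∈ Finset.range n, ξ i ω < 2 * ((0 : ℕ) : ℝ) - (n + 1 : ℕ) - 1} = 0 :=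
        le_antisymm ((measureReal_mono fun ω hω => by
          rw [Set.mem_ofPred_eq] at hω ⊢
          push_cast at hω
          linarith).trans h2.ge) measureReal_nonneg
      rw [cellProb_succ_zero, h1, h2]
      push_cast
      ring_nf
    · rw [cellProb_succ_succ, ih, ih]
      push_cast
      ring_nf

end Walk

theorem measureReal_Iio_gaussian (t : ℝ) :
    (gaussianReal 0 1).real (Set.Iio t) = stdNormalCDF t := by
  have := nullSingletonClass_gaussianReal (μ := 0) (v := 1) one_ne_zero
  rw [stdNormalCDF, cdf_eq_real]
  exact measureReal_congr Iio_ae_eq_Iic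

/-- `G n` is the strict distribution function of the normalized walk. Its monotonicity is kept so
that pointwise convergence can handle moving arguments. -/
theorem exists_cellProb_eq : ∃ G : ℕ → ℝ → ℝ, (∀ n, Monotone (G n)) ∧ (∀ n t, 0 ≤ G n t) ∧
    (∀ n t, G n t ≤ 1) ∧ (∀ t, Tendsto (fun n => G n t) atTop (𝓝 (stdNormalCDF t))) ∧
    ∀ n m : ℕ, 0 < n → cellProb (n + 1) m = G n ((2 * (m : ℝ) - n) / √n) := by
  obtain ⟨Ω, _, P, ξ, hmeas, hlaw, hindep, _⟩ := exists_iid ℕ fairSign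
  refine ⟨fun n t => P.real {ω | (√n)⁻¹ * ∑ i ∈ Finset.range n, ξ i ω < t}, fun n s t hst =>
    measureReal_mono fun ω (hω : _ < _) => hω.trans_le hst, fun n t => measureReal_nonneg,
    fun n t => measureReal_le_one, fun t => ?_, fun n m hn => ?_⟩
  · have h := tendstoInDistribution_inv_sqrt_mul_sum (P := P) (X := ξ)
      (HasLaw.id (μ := gaussianReal 0 1))
      (by rw [(hlaw 0).integral_eq, integral_fairSign]; norm_num)
      (by
        have := (hlaw 0).integral_comp (f := fun x : ℝ => x ^ 2) (by fun_prop)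
        rw [integral_fairSign] at this
        norm_num at this
        exact this) hindep
      (fun i => ⟨(hmeas i).aemeasurable, (hmeas 0).aemeasurable,
        by rw [(hlaw i).map_eq, (hlaw 0).map_eq]⟩)
    have hnull : ((gaussianReal 0 1).map id) (frontier (Set.Iio t)) = 0 := by
      have := nullSingletonClass_gaussianReal (μ := 0) (v := 1) one_ne_zero
      rw [Measure.map_id, frontier_Iio]
      simp
    have h2 := ProbabilityMeasure.tendsto_measure_of_null_frontier_of_tendsto' h.tendsto hnull
    simp only [ProbabilityMeasure.coe_mk, Measure.map_id] at h2
    have h3 := (ENNReal.tendsto_toReal (measure_ne_top _ _)).comp h2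
    rw [← measureReal_Iio_gaussian]
    refine h3.congr fun n => ?_
    have hm : Measurable fun ω => (√n)⁻¹ * ∑ i ∈ Finset.range n, ξ i ω :=
      (Finset.measurable_fun_sum _ fun i _ => hmeas i).const_mul _
    simp only [Function.comp]
    rw [Measure.map_apply hm measurableSet_Iio]
    rfl
  · rw [cellProb_eq_measureReal_walk hmeas hlaw hindep]
    have hn' : 0 < √(n : ℝ) := Real.sqrt_pos.2 (Nat.cast_pos.2 hn)
    congr 1
    ext ω
    rw [Set.mem_ofPred_eq, Set.mem_ofPred_eq, lt_div_iff₀ hn', mul_right_comm,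
      inv_mul_cancel₀ hn'.ne', one_mul]

theorem continuous_stdNormalCDF : Continuous stdNormalCDF := by
  have hna := nullSingletonClass_gaussianReal (μ := 0) (v := 1) one_ne_zero
  rw [continuous_iff_continuousAt]
  intro s
  have hmono := (cdf (gaussianReal 0 1)).mono
  -- The jump of a distribution function at `s` is the mass of `{s}`, which is zero here.
  refine hmono.continuousAt_iff_leftLim_eq_rightLim.2 ?_
  rw [StieltjesFunction.rightLim_eq]
  have h := (cdf (gaussianReal 0 1)).measure_singleton s
  rw [measure_cdf, measure_singleton] at h
  exact le_antisymm (hmono.leftLim_le le_rfl) (by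
    have := ENNReal.ofReal_eq_zero.1 h.symm
    linarith)

theorem stdNormalCDF_mem_Ioo (s : ℝ) : stdNormalCDF s ∈ Set.Ioo (0 : ℝ) 1 := by
  have hac := gaussianReal_absolutelyContinuous' 0 (v := 1) one_ne_zero
  have h1 : 0 < (gaussianReal 0 1).real (Set.Iic s) := by
    rw [measureReal_def, ENNReal.toReal_pos_iff]
    exact ⟨pos_iff_ne_zero.2 fun h => by simpa using hac h, measure_lt_top _ _⟩
  have h2 : 0 < (gaussianReal 0 1).real (Set.Ioi s) := by
    rw [measureReal_def, ENNReal.toReal_pos_iff]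
    exact ⟨pos_iff_ne_zero.2 fun h => by simpa using hac h, measure_lt_top _ _⟩
  have h3 := measureReal_add_measureReal_compl (μ := gaussianReal 0 1) (measurableSet_Iic (a := s))
  rw [Set.compl_Iic, probReal_univ] at h3
  rw [stdNormalCDF, cdf_eq_real]
  exact ⟨h1, by linarith⟩

theorem stdNormalCDF_zero : stdNormalCDF 0 = 1 / 2 := by
  have hna := nullSingletonClass_gaussianReal (μ := 0) (v := 1) one_ne_zero
  have h1 : (gaussianReal 0 1).real (Set.Iic 0) = (gaussianReal 0 1).real (Set.Ioi 0) := by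
    have h := gaussianReal_map_neg (μ := 0) (v := 1)
    rw [neg_zero] at h
    conv_lhs => rw [← h, map_measureReal_apply measurable_neg measurableSet_Iic]
    rw [measureReal_congr (Ioi_ae_eq_Ici (μ := gaussianReal 0 1))]
    congr 1
    ext y
    simp
  have h3 := measureReal_add_measureReal_compl (μ := gaussianReal 0 1) (measurableSet_Iic (a := 0))
  rw [Set.compl_Iic, probReal_univ] at h3
  rw [stdNormalCDF, cdf_eq_real]
  linarith

/-- The normal approximation of `cellProb` along sequences. -/
theorem tendsto_cellProb {n m : ℕ → ℕ} (hn : Tendsto n atTop atTop) :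
    (∀ s : ℝ, Tendsto (fun j => (2 * (m j : ℝ) - n j) / √(n j)) atTop (𝓝 s) →
      Tendsto (fun j => cellProb (n j + 1) (m j)) atTop (𝓝 (stdNormalCDF s))) ∧
    (Tendsto (fun j => (2 * (m j : ℝ) - n j) / √(n j)) atTop atTop →
      Tendsto (fun j => cellProb (n j + 1) (m j)) atTop (𝓝 1)) ∧
    (Tendsto (fun j => (2 * (m j : ℝ) - n j) / √(n j)) atTop atBot →
      Tendsto (fun j => cellProb (n j + 1) (m j)) atTop (𝓝 0)) := by
  obtain ⟨G, hmono, h0, h1, hlim, hG⟩ := exists_cellProb_eq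
  have heq : (fun j => G (n j) ((2 * (m j : ℝ) - n j) / √(n j))) =ᶠ[atTop]
      fun j => cellProb (n j + 1) (m j) := by
    filter_upwards [hn.eventually_gt_atTop 0] with j hj using (hG _ _ hj).symm
  -- The moving argument is compared with a fixed `t`, where the central limit theorem applies.
  have lower : ∀ {a t : ℝ}, a < stdNormalCDF t →
      (∀ᶠ j in atTop, t ≤ (2 * (m j : ℝ) - n j) / √(n j)) →
      ∀ᶠ j in atTop, a < G (n j) ((2 * (m j : ℝ) - n j) / √(n j)) := by
    intro a t ha ht
    filter_upwards [ht, ((hlim t).comp hn).eventually_const_lt ha] with j hj hj'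
    exact hj'.trans_le (hmono _ hj)
  have upper : ∀ {a t : ℝ}, stdNormalCDF t < a →
      (∀ᶠ j in atTop, (2 * (m j : ℝ) - n j) / √(n j) ≤ t) →
      ∀ᶠ j in atTop, G (n j) ((2 * (m j : ℝ) - n j) / √(n j)) < a := by
    intro a t ha ht
    filter_upwards [ht, ((hlim t).comp hn).eventually_lt_const ha] with j hj hj'
    exact (hmono _ hj).trans_lt hj'
  refine ⟨fun s hs => .congr' heq (tendsto_order.2 ⟨fun a ha => ?_, fun a ha => ?_⟩),
    fun hs => .congr' heq (tendsto_order.2 ⟨fun a ha => ?_, fun a ha => ?_⟩),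
    fun hs => .congr' heq (tendsto_order.2 ⟨fun a ha => ?_, fun a ha => ?_⟩)⟩
  · have hc := (continuous_stdNormalCDF.tendsto s).mono_left (nhdsWithin_le_nhds (s := Set.Iio s))
    obtain ⟨t, ht, hts⟩ := ((hc.eventually_const_lt ha).and self_mem_nhdsWithin).exists
    exact lower ht ((hs.eventually_const_lt hts).mono fun j hj => hj.le)
  · have hc := (continuous_stdNormalCDF.tendsto s).mono_left (nhdsWithin_le_nhds (s := Set.Ioi s))
    obtain ⟨t, ht, hts⟩ := ((hc.eventually_lt_const ha).and self_mem_nhdsWithin).exists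
    exact upper ht ((hs.eventually_lt_const hts).mono fun j hj => hj.le)
  · obtain ⟨t, ht⟩ :=
      ((tendsto_cdf_atTop (gaussianReal 0 1)).eventually_const_lt ha).exists
    exact lower ht (hs.eventually_ge_atTop t)
  · exact Eventually.of_forall fun j => (h1 _ _).trans_lt ha
  · exact Eventually.of_forall fun j => ha.trans_le (h0 _ _)
  · obtain ⟨t, ht⟩ :=
      ((tendsto_cdf_atBot (gaussianReal 0 1)).eventually_lt_const ha).exists
    exact upper ht (hs.eventually_le_atBot t)

end

/-! ### Scaling of the parameters -/

/-- If `n_d / d` has a positive limit then `n_d → ∞`. -/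
theorem tendsto_atTop_of_div_tendsto {n : ℕ → ℕ} {a : ℝ} (ha : 0 < a)
    (h : Tendsto (fun d : ℕ => (n d : ℝ) / d) atTop (𝓝 a)) : Tendsto n atTop atTop := by
  rw [← tendsto_natCast_atTop_iff (R := ℝ)]
  refine (h.pos_mul_atTop ha tendsto_natCast_atTop_atTop).congr' ?_
  filter_upwards [eventually_gt_atTop 0] with d hd
  have : (d : ℝ) ≠ 0 := by positivity
  field_simp

section Asymptotics

variable {δ : ℝ} {N k : ℕ → ℕ}

theorem tendsto_N_div (hδ : 1 / 2 < δ)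
    (hN : Tendsto (fun d : ℕ => (d : ℝ) / (N d : ℝ)) atTop (𝓝 δ)) :
    Tendsto (fun d : ℕ => (N d : ℝ) / d) atTop (𝓝 δ⁻¹) := by
  refine (hN.inv₀ (by linarith)).congr fun d => ?_
  rw [inv_div]

/-- The probability that the positive hull is proper tends to one. -/
theorem tendsto_cellProb_denominator (hδ : 1 / 2 < δ) (hkN : ∀ᶠ d in atTop, k d < d ∧ d < N d)
    (hN : Tendsto (fun d : ℕ => (d : ℝ) / (N d : ℝ)) atTop (𝓝 δ)) :
    Tendsto (fun d => cellProb (N d) d) atTop (𝓝 1) := by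
  have hinv : Tendsto (fun d : ℕ => ((d : ℝ))⁻¹) atTop (𝓝 0) := tendsto_inv_atTop_nhds_zero_nat
  have hcast : ∀ᶠ d in atTop, ((N d - 1 : ℕ) : ℝ) = N d - 1 ∧ (0 : ℝ) < d := by
    filter_upwards [hkN] with d hd
    exact ⟨by rw [Nat.cast_sub (by omega)]; simp, Nat.cast_pos.2 (by omega)⟩
  have hn : Tendsto (fun d : ℕ => ((N d - 1 : ℕ) : ℝ) / d) atTop (𝓝 δ⁻¹) := by
    have h := (tendsto_N_div hδ hN).sub hinv
    rw [sub_zero] at h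
    refine h.congr' ?_
    filter_upwards [hcast] with d hd
    rw [hd.1, sub_div, one_div]
  have hδ0 : 0 < δ⁻¹ := inv_pos.2 (by linarith)
  have hδ2 : 0 < 2 - δ⁻¹ := by
    have : δ⁻¹ < 2 := by
      rw [inv_lt_comm₀ (by linarith) (by norm_num)]
      linarith
    linarith
  have hs : Tendsto (fun d : ℕ => (2 * (d : ℝ) - ((N d - 1 : ℕ) : ℝ)) / √((N d - 1 : ℕ) : ℝ))
      atTop atTop := by
    -- After division by `d` the threshold tends to `2 - δ⁻¹ > 0`, so the normalized argument grows
    -- like `√d`.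
    have h1 := (tendsto_const_nhds (x := (2 : ℝ))).sub hn
    have h2 := h1.div hn.sqrt (Real.sqrt_pos.2 hδ0).ne'
    have h3 := h2.pos_mul_atTop (div_pos hδ2 (Real.sqrt_pos.2 hδ0))
      (Real.tendsto_sqrt_atTop.comp tendsto_natCast_atTop_atTop)
    refine h3.congr' ?_
    filter_upwards [hcast] with d hd
    have hd0 := hd.2
    have hsq : √(d : ℝ) * √(d : ℝ) = d := Real.mul_self_sqrt hd0.le
    simp only [Function.comp, Pi.div_apply]
    rw [Real.sqrt_div' _ hd0.le, div_div_eq_mul_div, div_mul_eq_mul_div, mul_assoc, hsq]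
    congr 1
    field_simp
  have h := (tendsto_cellProb (m := fun d => d) (tendsto_atTop_of_div_tendsto hδ0 hn)).2.1 hs
  refine h.congr' ?_
  filter_upwards [hkN] with d hd
  rw [show N d - 1 + 1 = N d by omega]

/-- The rescaled argument of the normal approximation in the numerator. -/
theorem exists_scaling (hδ : 1 / 2 < δ) (hδ1 : δ < 1) {ρ : ℝ} (hρ : ρ = rhoW δ)
    (hkN : ∀ᶠ d in atTop, k d < d ∧ d < N d)
    (hN : Tendsto (fun d : ℕ => (d : ℝ) / (N d : ℝ)) atTop (𝓝 δ))
    (hk : Tendsto (fun d : ℕ => (k d : ℝ) / (d : ℝ)) atTop (𝓝 ρ)) :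
    0 < 2 * (1 - ρ) ∧ Tendsto (fun d => N d - k d - 1) atTop atTop ∧
    ∃ R : ℕ → ℝ, Tendsto R atTop (𝓝 (√(2 * (1 - ρ)))⁻¹) ∧
      ∀ᶠ d : ℕ in atTop,
        (-(((N d : ℝ) - 2 * (d : ℝ) + (k d : ℝ)) / √(d : ℝ)) + (√(d : ℝ))⁻¹) * R d =
        (2 * ((d - k d : ℕ) : ℝ) - ((N d - k d - 1 : ℕ) : ℝ)) / √((N d - k d - 1 : ℕ) : ℝ) := by
  have hδ2 : δ⁻¹ < 2 := by
    rw [inv_lt_comm₀ (by linarith) (by norm_num)]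
    linarith
  have hδ3 : 1 < δ⁻¹ := (one_lt_inv₀ (by linarith)).2 hδ1
  have hρ' : ρ = 2 - δ⁻¹ := by rw [hρ, rhoW, max_eq_right (by linarith)]
  have hpos : 0 < 2 * (1 - ρ) := by linarith
  have hinv : Tendsto (fun d : ℕ => ((d : ℝ))⁻¹) atTop (𝓝 0) := tendsto_inv_atTop_nhds_zero_nat
  have hcast : ∀ᶠ d in atTop, ((N d - k d - 1 : ℕ) : ℝ) = N d - k d - 1 ∧
      ((d - k d : ℕ) : ℝ) = d - k d ∧ (0 : ℝ) < d := by
    filter_upwards [hkN] with d hd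
    refine ⟨?_, by rw [Nat.cast_sub hd.1.le], Nat.cast_pos.2 (by omega)⟩
    rw [Nat.cast_sub (by omega), Nat.cast_sub (by omega)]
    simp
  have hn : Tendsto (fun d : ℕ => ((N d - k d - 1 : ℕ) : ℝ) / d) atTop (𝓝 (2 * (1 - ρ))) := by
    have h := ((tendsto_N_div hδ hN).sub hk).sub hinv
    rw [show δ⁻¹ - ρ - 0 = 2 * (1 - ρ) by rw [hρ']; ring] at h
    refine h.congr' ?_
    filter_upwards [hcast] with d hd
    rw [hd.1, sub_div, sub_div, one_div]
  refine ⟨hpos, tendsto_atTop_of_div_tendsto hpos hn,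
    -- `R` changes the normalization from `√d` to the square root of the number of steps; the
    -- summand `(√d)⁻¹` comes from the `-1` in that number.
    fun d => (√(((N d - k d - 1 : ℕ) : ℝ) / d))⁻¹,
    hn.sqrt.inv₀ (Real.sqrt_pos.2 hpos).ne', ?_⟩
  filter_upwards [hcast] with d hd
  have hsd : 0 < √(d : ℝ) := Real.sqrt_pos.2 hd.2.2
  rw [Real.sqrt_div' _ hd.2.2.le, inv_div, hd.2.1, ← mul_div_assoc]
  congr 1
  rw [hd.1, add_mul, neg_mul, div_mul_cancel₀ _ hsd.ne', inv_mul_cancel₀ hsd.ne']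
  ring

end Asymptotics

theorem tendsto_div_sqrt_atTop {A : ℕ → ℝ} {α c : ℝ} (hα : 1 / 2 < α) (hc : 0 < c)
    (h : ∀ᶠ d : ℕ in atTop, c * (d : ℝ) ^ α ≤ A d) :
    Tendsto (fun d : ℕ => A d / √(d : ℝ)) atTop atTop := by
  have h1 : Tendsto (fun d : ℕ => c * (d : ℝ) ^ (α - 1 / 2)) atTop atTop :=
    ((tendsto_rpow_atTop (by linarith)).comp tendsto_natCast_atTop_atTop).const_mul_atTop hc
  refine tendsto_atTop_mono' _ ?_ h1
  filter_upwards [h, eventually_gt_atTop 0] with d hd hd0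
  have hd0 : (0 : ℝ) < d := Nat.cast_pos.2 hd0
  rw [le_div_iff₀ (Real.sqrt_pos.2 hd0), mul_assoc, Real.sqrt_eq_rpow, ← Real.rpow_add hd0]
  simpa using hd

/-! ### The four regimes at the threshold -/

theorem mainTheorem1
    (δ ρ : ℝ) (hδ : 1 / 2 < δ) (hδ1 : δ < 1) (hρ : ρ = rhoW δ)
    (N k : ℕ → ℕ)
    (hkN : ∀ᶠ d in atTop, k d < d ∧ d < N d)
    (hN : Tendsto (fun d : ℕ => (d : ℝ) / (N d : ℝ)) atTop (𝓝 δ))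
    (hk : Tendsto (fun d : ℕ => (k d : ℝ) / (d : ℝ)) atTop (𝓝 ρ))
    (φ : ∀ d : ℕ, Measure (EuclideanSpace ℝ (Fin d)))
    (hφ : ∀ d, IsEvenGeneric (φ d))
    {Ω : ℕ → Type*} [∀ d, MeasurableSpace (Ω d)]
    (P : ∀ d, Measure (Ω d)) [∀ d, IsProbabilityMeasure (P d)]
    (X : ∀ d, Fin (N d) → Ω d → EuclideanSpace ℝ (Fin d))
    (hXmeas : ∀ d i, Measurable (X d i))
    (hXlaw : ∀ d i, (P d).map (X d i) = φ d)
    (hXindep : ∀ d, iIndepFun (X d) (P d)) :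
    -- the expectations below are well defined
    (∀ᶠ d in atTop, P d (posHullProper (X d)) ≠ 0 ∧
      Integrable (fun ω => (faceNumber (k d) (posHull (fun i => X d i ω)) : ℝ))
        (coverEfronMeasure (P d) (X d))) ∧
    -- (a)
    (∀ c : ℝ,
      Tendsto (fun d : ℕ => ((N d : ℝ) - 2 * (d : ℝ) + (k d : ℝ)) / Real.sqrt (d : ℝ))
        atTop (𝓝 c) →
      Tendsto (fun d : ℕ =>
          expectedFaceNumber (P d) (X d) (k d) / ((N d).choose (k d) : ℝ))
        atTop (𝓝 (stdNormalCDF (-c / Real.sqrt (2 * (1 - ρ))))) ∧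
      stdNormalCDF (-c / Real.sqrt (2 * (1 - ρ))) ∈ Set.Ioo (0 : ℝ) 1) ∧
    -- (b)
    (∀ α c : ℝ, 1 / 2 < α → α < 1 → 0 < c →
      (∀ᶠ d : ℕ in atTop, c * (d : ℝ) ^ α ≤ (N d : ℝ) - 2 * (d : ℝ) + (k d : ℝ)) →
      Tendsto (fun d : ℕ =>
          expectedFaceNumber (P d) (X d) (k d) / ((N d).choose (k d) : ℝ))
        atTop (𝓝 0)) ∧
    -- (c)
    (∀ α c : ℝ, 0 < α → α < 1 / 2 → 0 ≤ c →
      (∀ᶠ d : ℕ in atTop, -(c * (d : ℝ) ^ α) ≤ (N d : ℝ) - 2 * (d : ℝ) + (k d : ℝ) ∧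
        (N d : ℝ) - 2 * (d : ℝ) + (k d : ℝ) ≤ c * (d : ℝ) ^ α) →
      Tendsto (fun d : ℕ =>
          expectedFaceNumber (P d) (X d) (k d) / ((N d).choose (k d) : ℝ))
        atTop (𝓝 (1 / 2))) ∧
    -- (d)
    (∀ α c : ℝ, 1 / 2 < α → α < 1 → c < 0 →
      (∀ᶠ d : ℕ in atTop, (N d : ℝ) - 2 * (d : ℝ) + (k d : ℝ) ≤ c * (d : ℝ) ^ α) →
      Tendsto (fun d : ℕ =>
          expectedFaceNumber (P d) (X d) (k d) / ((N d).choose (k d) : ℝ))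
        atTop (𝓝 1)) := by

  have hmain : ∀ᶠ d in atTop, expectedFaceNumber (P d) (X d) (k d) / ((N d).choose (k d) : ℝ) =
      cellProb (N d - k d - 1 + 1) (d - k d) / cellProb (N d) d := by
    filter_upwards [hkN] with d hd
    rw [expectedFaceNumber_eq (hφ d) (hXmeas d) (hXlaw d) (hXindep d) hd.2 hd.1,
      mul_div_cancel_left₀ _ (Nat.cast_ne_zero.2 (Nat.choose_pos (by omega)).ne'),
      show N d - k d - 1 + 1 = N d - k d by omega]
  have hden := tendsto_cellProb_denominator hδ hkN hN
  obtain ⟨hpos, hn, R, hR, hRs⟩ := exists_scaling hδ hδ1 hρ hkN hN hk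
  have hRpos : 0 < (√(2 * (1 - ρ)))⁻¹ := inv_pos.2 (Real.sqrt_pos.2 hpos)
  have hsq : Tendsto (fun d : ℕ => (√(d : ℝ))⁻¹) atTop (𝓝 0) :=
    (Real.tendsto_sqrt_atTop.comp tendsto_natCast_atTop_atTop).inv_tendsto_atTop
  obtain ⟨hfin, htop, hbot⟩ := tendsto_cellProb (m := fun d => d - k d) hn
  have hratio : ∀ l : ℝ, Tendsto (fun d => cellProb (N d - k d - 1 + 1) (d - k d)) atTop (𝓝 l) →
      Tendsto (fun d : ℕ => expectedFaceNumber (P d) (X d) (k d) / ((N d).choose (k d) : ℝ))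
        atTop (𝓝 l) := by
    intro l hl
    have h := hl.div hden one_ne_zero
    rw [div_one] at h
    exact h.congr' (hmain.mono fun d hd => hd.symm)
  have ha : ∀ c : ℝ,
      Tendsto (fun d : ℕ => ((N d : ℝ) - 2 * (d : ℝ) + (k d : ℝ)) / Real.sqrt (d : ℝ))
        atTop (𝓝 c) →
      Tendsto (fun d : ℕ => expectedFaceNumber (P d) (X d) (k d) / ((N d).choose (k d) : ℝ))
        atTop (𝓝 (stdNormalCDF (-c / Real.sqrt (2 * (1 - ρ))))) := by
    intro c hc
    refine hratio _ (hfin _ (Tendsto.congr' hRs ?_))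
    have h := (hc.neg.add hsq).mul hR
    rwa [add_zero, ← div_eq_mul_inv] at h
  refine ⟨?_, fun c hc => ⟨ha c hc, stdNormalCDF_mem_Ioo _⟩, ?_, ?_, ?_⟩
  · filter_upwards [hkN] with d hd
    exact ⟨measure_posHullProper_ne_zero (hφ d) (hXmeas d) (hXlaw d) (hXindep d) (by omega) hd.2,
      integrable_faceNumber_coverEfron (hφ d) (hXmeas d) (hXlaw d) (hXindep d) hd.2 hd.1⟩
  · intro α c hα _ hc h
    refine hratio _ (hbot (Tendsto.congr' hRs ?_))
    have hA := tendsto_div_sqrt_atTop hα hc h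
    exact ((tendsto_neg_atTop_atBot.comp hA).atBot_add hsq).atBot_mul_pos hRpos hR
  · intro α c _ hα hc h
    have hA : Tendsto (fun d : ℕ => ((N d : ℝ) - 2 * (d : ℝ) + (k d : ℝ)) / Real.sqrt (d : ℝ))
        atTop (𝓝 0) := by
      -- The bound `c * d ^ α` divided by `√d` vanishes, so this regime is (a) with limit 0, where
      -- the normal distribution function is `1 / 2`.
      have h1 : Tendsto (fun d : ℕ => c * (d : ℝ) ^ (-(1 / 2 - α))) atTop (𝓝 0) := by
        simpa using ((tendsto_rpow_neg_atTop (by linarith : 0 < 1 / 2 - α)).comp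
          tendsto_natCast_atTop_atTop).const_mul c
      refine squeeze_zero_norm' ?_ h1
      filter_upwards [h, eventually_gt_atTop 0] with d hd hd0
      have hd0 : (0 : ℝ) < d := Nat.cast_pos.2 hd0
      rw [Real.norm_eq_abs, abs_div, abs_of_pos (Real.sqrt_pos.2 hd0),
        div_le_iff₀ (Real.sqrt_pos.2 hd0), mul_assoc, Real.sqrt_eq_rpow, ← Real.rpow_add hd0,
        show -(1 / 2 - α) + 1 / 2 = α by ring, abs_le]
      exact hd
    have := ha 0 hA
    rwa [neg_zero, zero_div, stdNormalCDF_zero] at this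
  · intro α c hα _ hc h
    refine hratio _ (htop (Tendsto.congr' hRs ?_))
    have hA := tendsto_div_sqrt_atTop (A := fun d => -((N d : ℝ) - 2 * (d : ℝ) + (k d : ℝ))) hα
      (neg_pos.2 hc) (h.mono fun d hd => by linarith)
    simp only [neg_div] at hA
    exact (hA.atTop_add hsq).atTop_mul_pos hRpos hR
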